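/- Let $\mathsf{At}$ be a non-empty set of atoms and $I$ a non-empty set of individuals. The language $\mathcal L$ is given by $\varphi ::= \top \mid p \mid \neg\varphi \mid \varphi\wedge\varphi \mid \ell_i\varphi \mid a_i\varphi \mid k_i\varphi$ ($p\in\mathsf{At}$, $i\in I$; implicit knowledge, awareness, explicit knowledge), with $\varphi\to\psi := \neg(\varphi\wedge\neg\psi)$ and $\leftrightarrow$ as usual. $\mathsf{At}(\varphi)$ is the set of atoms occurring in $\varphi$ and $\mathcal L_\Phi=\{\varphi : \mathsf{At}(\varphi)\subseteq\Phi\}$. **Logic.** LPA is the smallest set of formulas that contains all substitution instances of propositional tautologies (including $\top$) and all instances of $(\ell_i\varphi\wedge\ell_i(\varphi\to\psi))\to\ell_i\psi$; $k_i\varphi\leftrightarrow(\ell_i\varphi\wedge a_i\varphi)$; $a_i(\varphi\wedge\psi)\leftrightarrow(a_i\varphi\wedge a_i\psi)$; $a_i\neg\varphi\leftrightarrow a_i\varphi$; $a_ik_j\varphi\leftrightarrow a_i\varphi$; $a_ia_j\varphi\leftrightarrow a_i\varphi$; $a_i\ell_j\varphi\leftrightarrow a_i\varphi$; $a_i\varphi\to\ell_ia_i\varphi$;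 $\neg a_i\varphi\to\ell_i\neg a_i\varphi$; $\ell_i\varphi\to\varphi$; $\ell_i\varphi\to\ell_i\ell_i\varphi$; $\neg\ell_i\varphi\to\ell_i\neg\ell_i\varphi$, and is closed under modus ponens and under passing from $\varphi$ to $\ell_i\varphi$. $\mathrm{LPA}_\top$ is defined in the same way with the additional axioms $a_i\top$ ($i\in I$). **FH models.** An FH model $\mathsf K_\Phi$ for $\Phi\subseteq\mathsf{At}$ has a non-empty set $W_\Phi$ of states, equivalence relations $R_{\Phi,i}$ on $W_\Phi$, awareness sets $\mathcal A_{\Phi,i}(w)\subseteq\mathcal L_\Phi$ and a valuation $V_\Phi:\Phi\to 2^{W_\Phi}$, such that a formula $\varphi\in\mathcal L_\Phi$ is in $\mathcal A_{\Phi,i}(w)$ iff all $p\in\mathsf{At}(\varphi)$ are, and $(w,t)\in R_{\Phi,i}$ implies $\mathcal A_{\Phi,i}(w)=\mathcal A_{\Phi,i}(t)$. For formulas in $\mathcal L_\Phi$, truth of atoms is given by $V_\Phi$, the Boolean clauses are the usual ones, $a_i\varphi$ is true at $w$ iff $\varphi\in\mathcal A_{\Phi,i}(w)$, $\ell_i\varphi$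 iff $\varphi$ is true at all $t$ with $(w,t)\in R_{\Phi,i}$, and $k_i\varphi$ iff both $\ell_i\varphi$ and $a_i\varphi$ are. A category of FH models consists of an FH model $\mathsf K_\Phi$ for every $\Phi\subseteq\mathsf{At}$ and maps $f^\Phi_\Psi:W_\Phi\to W_\Psi$ for $\Psi\subseteq\Phi$, with $f^\Phi_\Phi=\mathrm{id}$ and $f^\Phi_\Upsilon=f^\Psi_\Upsilon\circ f^\Phi_\Psi$, that are surjective bounded morphisms: they are surjective, preserve and reflect the atoms in $\Psi$, satisfy $\mathcal A_{\Phi,i}(w)\cap\mathcal L_\Psi=\mathcal A_{\Psi,i}(f^\Phi_\Psi(w))$, are homomorphisms for the relations, and satisfy the back condition: if $(f^\Phi_\Psi(w),t')\in R_{\Psi,i}$ then $t'=f^\Phi_\Psi(t)$ for some $t$ with $(w,t)\in R_{\Phi,i}$. A formula $\varphi$ is valid in the category if it is true at every state of every $\mathsf K_\Psi$ with $\mathsf{At}(\varphi)\subseteq\Psi$. **State spaces and events.** A projective system of state spaces consists of non-empty disjoint sets $S_\Phi$ ($\Phi\subseteq\mathsf{At}$) with union $\Omega$ and surjections $r^\Phi_\Psi:S_\Phi\to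 S_\Psi$ ($\Psi\subseteq\Phi$) with $r^\Phi_\Phi=\mathrm{id}$ and $r^\Phi_\Upsilon=r^\Psi_\Upsilon\circ r^\Phi_\Psi$; write $\omega_\Psi=r^\Phi_\Psi(\omega)$ for $\omega\in S_\Phi$, let $D_\Psi$ be the set of the projections to $S_\Psi$ of the elements of $D$, and let $D^\uparrow$ be the set of the states that project to an element of $D$. An event is a set $D^\uparrow$ with $D\subseteq S_\Phi$, together with its base-space $S_\Phi$; its negation is $(S_\Phi\setminus D)^\uparrow$ with the same base-space, and the base-space of $E\cap F$ is $S_{\Phi\cup\Psi}$ if $E,F$ have base-spaces $S_\Phi,S_\Psi$. A valuation $v$ maps atoms to events. **Complemented HMS models.** These have a projective system of state spaces, a valuation $v$, and for each $i$ maps $\Pi_i:\Omega\to2^\Omega\setminus\{\emptyset\}$ and $\Lambda_i:\Omega\to2^\Omega$ such that, for all $\omega\in S_\Phi$: $\Pi_i(\omega)\subseteq S_\Psi$ for some $\Psi\subseteq\Phi$ (write $S_{\Pi_i(\omega)}=S_\Psi$); $\omega\in\Pi_i(\omega)^\uparrow$; $\omega'\in\Pi_i(\omega)$ implies $\Pi_i(\omega')=\Pi_i(\omega)$;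 $\Pi_i(\omega)^\uparrow\subseteq\Pi_i(\omega_\Psi)^\uparrow$ for $\Psi\subseteq\Phi$; $\Pi_i(\omega)_\Upsilon=\Pi_i(\omega_\Upsilon)$ if $\Pi_i(\omega)\subseteq S_\Psi$ and $\Upsilon\subseteq\Psi\subseteq\Phi$; $\omega\in\Lambda_i(\omega)$; $\omega'\in\Lambda_i(\omega)$ implies $\Lambda_i(\omega')=\Lambda_i(\omega)$ and $\Pi_i(\omega')=\Pi_i(\omega)$; $\Lambda_i(\omega)_\Psi=\Lambda_i(\omega_\Psi)$ for $\Psi\subseteq\Phi$ (so $\Lambda_i(\omega)\subseteq S_\Phi$); $\omega'\in\Pi_i(\omega)$ implies $\Lambda_i(\omega')=\Lambda_i(\omega)_{S_{\Pi_i(\omega)}}$. With $[\varphi]$ the event that $\varphi$ is true and $S([\varphi])$ its base-space: $[\top]=\Omega$ (base-space $S_\emptyset$), $[p]=v(p)$, $[\neg\varphi]=\neg[\varphi]$, $[\varphi\wedge\psi]=[\varphi]\cap[\psi]$, and $\ell_i\varphi$, $k_i\varphi$, $a_i\varphi$ are true at $\omega$ iff $\Lambda_i(\omega)\subseteq[\varphi]$,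 $\Pi_i(\omega)\subseteq[\varphi]$, and $S_{\Pi_i(\omega)}$ is at least as expressive as $S([\varphi])$ (its index contains that of $S([\varphi])$), respectively; the last three events have base-space $S([\varphi])$. **Implicit knowledge-based HMS models.** These have a projective system of state spaces, a valuation, maps $\Lambda_i$ with $\omega\in\Lambda_i(\omega)$, $\Lambda_i(\omega')=\Lambda_i(\omega)$ for $\omega'\in\Lambda_i(\omega)$ and $\Lambda_i(\omega)_\Psi=\Lambda_i(\omega_\Psi)$ for $\omega\in S_\Phi$, $\Psi\subseteq\Phi$, and awareness functions $\alpha_i:\Omega\to2^{\mathsf{At}}$ (indices of spaces) such that for $\omega\in S_\Phi$: $\alpha_i(\omega)\subseteq\Phi$; $\alpha_i(\omega')=\alpha_i(\omega)$ for $\omega'\in\Lambda_i(\omega)$; $\alpha_i(\omega_\Psi)=\Psi$ if $\Psi\subseteq\alpha_i(\omega)$; $\alpha_i(\omega_\Psi)=\alpha_i(\omega)$ if $\alpha_i(\omega)\subseteq\Psi\subseteq\Phi$; $\alpha_i(\omega_\Psi)\subseteq\alpha_i(\omega)$ if $\Psi\subseteq\Phi$. Truth is as above with $\Pi_i(\omega):=\Lambda_i(\omega)_{\alpha_i(\omega)}$,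 except that $a_i\varphi$ is true at $\omega$ iff $\alpha_i(\omega)$ contains the index of $S([\varphi])$. In both kinds of HMS models $\varphi$ is defined at $\omega$ if $\omega\in v(p)\cup\neg v(p)$ for all $p\in\mathsf{At}(\varphi)$, and $\varphi$ is valid in the model if it is true at all states at which it is defined. A formula is valid in a class if it is valid in every member. **Theorem.** Consider each of the following classes: (1) all categories of FH models, (2) all complemented HMS models, (3) all implicit knowledge-based HMS models. (a) $\mathrm{LPA}_\top$ is sound and complete with respect to the class: a formula $\varphi\in\mathcal L$ belongs to $\mathrm{LPA}_\top$ if and only if it is valid in the class. (b) LPA is sound with respect to the class, and it is complete for the formulas in which $\top$ does not occur in the scope of an operator $a_i$ or $k_i$: every such formula that is valid in the class belongs to LPA. -/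

import Mathlib

universe u v w

/-! ### The language -/

/-- Formulas over the atoms `At` and the individuals `I`: implicit knowledge `ell i`,
awareness `aware i`, explicit knowledge `know i`. -/
inductive Formula (At : Type u) (I : Type v) : Type (max u v)
  | top : Formula At I
  | atom : At → Formula At I
  | neg : Formula At I → Formula At I
  | conj : Formula At I → Formula At I → Formula At I
  | ell : I → Formula At I → Formula At I
  | aware : I → Formula At I → Formula At I
  | know : I → Formula At I → Formula At I

namespace Formula

variable {At : Type u} {I : Type v}

/-- `φ → ψ` abbreviates `¬(φ ∧ ¬ψ)`. -/
def imp (φ ψ : Formula At I) : Formula At I := neg (conj φ (neg ψ))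

/-- `φ ↔ ψ` abbreviates `(φ → ψ) ∧ (ψ → φ)`. -/
def biimp (φ ψ : Formula At I) : Formula At I := conj (imp φ ψ) (imp ψ φ)

/-- The set of atoms occurring in a formula. -/
def atoms : Formula At I → Set At
  | top => ∅
  | atom p => {p}
  | neg φ => atoms φ
  | conj φ ψ => atoms φ ∪ atoms ψ
  | ell _ φ => atoms φ
  | aware _ φ => atoms φ
  | know _ φ => atoms φ

/-- The sublanguage of the formulas all of whose atoms are in `Φ`. -/
def sublanguage (Φ : Set At) : Set (Formula At I) := {φ | φ.atoms ⊆ Φ}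

/-- Evaluation in propositional logic: atoms and formulas that start with a modal operator
are treated as propositional letters, with truth values given by `e`. -/
def propEval (e : Formula At I → Prop) : Formula At I → Prop
  | top => True
  | neg φ => ¬ propEval e φ
  | conj φ ψ => propEval e φ ∧ propEval e ψ
  | atom p => e (atom p)
  | ell i φ => e (ell i φ)
  | aware i φ => e (aware i φ)
  | know i φ => e (know i φ)

/-- Substitution instances of propositional tautologies. -/
def IsTautology (φ : Formula At I) : Prop := ∀ e : Formula At I → Prop, propEval e φ

/-- The constant `⊤` does not occur. -/
def TopFree : Formula At I → Prop
  | top => False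
  | atom _ => True
  | neg φ => TopFree φ
  | conj φ ψ => TopFree φ ∧ TopFree ψ
  | ell _ φ => TopFree φ
  | aware _ φ => TopFree φ
  | know _ φ => TopFree φ

/-- The constant `⊤` does not occur in the scope of an awareness or explicit knowledge operator. -/
def TopGuarded : Formula At I → Prop
  | top => True
  | atom _ => True
  | neg φ => TopGuarded φ
  | conj φ ψ => TopGuarded φ ∧ TopGuarded ψ
  | ell _ φ => TopGuarded φ
  | aware _ φ => TopFree φ
  | know _ φ => TopFree φ

end Formula

/-! ### The Logic of Propositional Awareness -/

open Formula in
/-- Derivability from the axioms and rules of the Logic of Propositional Awareness together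
with the additional axioms in `X`. -/
inductive LPAWith {At : Type u} {I : Type v} (X : Set (Formula At I)) : Formula At I → Prop
  | extra {φ} : φ ∈ X → LPAWith X φ
  | taut {φ} : IsTautology φ → LPAWith X φ
  | axK (i φ ψ) : LPAWith X (imp (conj (ell i φ) (ell i (imp φ ψ))) (ell i ψ))
  | explicitKnowledge (i φ) :
      LPAWith X (biimp (know i φ) (conj (ell i φ) (aware i φ)))
  | axA1 (i φ ψ) :
      LPAWith X (biimp (aware i (conj φ ψ)) (conj (aware i φ) (aware i ψ)))
  | axA2 (i φ) : LPAWith X (biimp (aware i (neg φ)) (aware i φ))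
  | axA3 (i j φ) : LPAWith X (biimp (aware i (know j φ)) (aware i φ))
  | axA4 (i j φ) : LPAWith X (biimp (aware i (aware j φ)) (aware i φ))
  | axA5 (i j φ) : LPAWith X (biimp (aware i (ell j φ)) (aware i φ))
  | axA11 (i φ) : LPAWith X (imp (aware i φ) (ell i (aware i φ)))
  | axA12 (i φ) : LPAWith X (imp (neg (aware i φ)) (ell i (neg (aware i φ))))
  | modusPonens {φ ψ} : LPAWith X φ → LPAWith X (imp φ ψ) → LPAWith X ψ
  | necessitation (i) {φ} : LPAWith X φ → LPAWith X (ell i φ)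
  | axT (i φ) : LPAWith X (imp (ell i φ) φ)
  | ax4 (i φ) : LPAWith X (imp (ell i φ) (ell i (ell i φ)))
  | ax5 (i φ) : LPAWith X (imp (neg (ell i φ)) (ell i (neg (ell i φ))))

/-- The Logic of Propositional Awareness. -/
def LPA (At : Type u) (I : Type v) : Set (Formula At I) := {φ | LPAWith ∅ φ}

/-- The Logic of Propositional Awareness with the axioms `a_i ⊤` for all individuals `i`. -/
def LPATop (At : Type u) (I : Type v) : Set (Formula At I) :=
  {φ | LPAWith (Set.range fun i : I => Formula.aware i Formula.top) φ}

/-! ### FH models and categories of FH models -/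

/-- A partitional and propositionally determined FH model for `Φ ⊆ At`. -/
structure FHModel (At : Type u) (I : Type v) (Φ : Set At) where
  /-- states -/
  W : Type w
  nonempty : Nonempty W
  /-- accessibility relations -/
  R : I → W → W → Prop
  /-- awareness sets -/
  A : I → W → Set (Formula At I)
  /-- valuation -/
  V : Φ → Set W
  A_subset : ∀ i x, A i x ⊆ Formula.sublanguage Φ
  /-- awareness is generated by primitive propositions -/
  generated : ∀ i x, ∀ φ ∈ Formula.sublanguage Φ,
    φ ∈ A i x ↔ ∀ p ∈ φ.atoms, Formula.atom p ∈ A i x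
  /-- agents know what they are aware of -/
  knowAware : ∀ i x y, R i x y → A i x = A i y
  partitional : ∀ i, Equivalence (R i)

/-- Satisfaction in an FH model for `Φ`; only meant for formulas of the sublanguage of `Φ`. -/
def FHModel.Sat {At : Type u} {I : Type v} {Φ : Set At} (K : FHModel.{u, v, w} At I Φ) :
    Formula At I → K.W → Prop
  | .top, _ => True
  | .atom p, x => ∃ h : p ∈ Φ, x ∈ K.V ⟨p, h⟩
  | .neg φ, x => ¬ K.Sat φ x
  | .conj φ ψ, x => K.Sat φ x ∧ K.Sat ψ x
  | .ell i φ, x => ∀ y, K.R i x y → K.Sat φ y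
  | .aware i φ, x => φ ∈ K.A i x
  | .know i φ, x => (∀ y, K.R i x y → K.Sat φ y) ∧ φ ∈ K.A i x

/-- Surjective bounded morphisms from an FH model for `Φ` to one for `Ψ ⊆ Φ`. -/
structure IsSurjBoundedMorphism {At : Type u} {I : Type v} {Φ Ψ : Set At} (h : Ψ ⊆ Φ)
    (K : FHModel.{u, v, w} At I Φ) (K' : FHModel.{u, v, w} At I Ψ) (f : K.W → K'.W) :
    Prop where
  surjective : Function.Surjective f
  atomicHarmony : ∀ (p : Ψ) (x : K.W), x ∈ K.V ⟨p, h p.2⟩ ↔ f x ∈ K'.V p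
  awarenessConsistency : ∀ i x, K.A i x ∩ Formula.sublanguage Ψ = K'.A i (f x)
  homomorphism : ∀ i x y, K.R i x y → K'.R i (f x) (f y)
  back : ∀ i x y', K'.R i (f x) y' → ∃ y, f y = y' ∧ K.R i x y

/-- A category of FH models. -/
structure FHCategory (At : Type u) (I : Type v) where
  K : ∀ Φ : Set At, FHModel.{u, v, w} At I Φ
  f : ∀ {Φ Ψ : Set At}, Ψ ⊆ Φ → (K Φ).W → (K Ψ).W
  morphism : ∀ {Φ Ψ : Set At} (h : Ψ ⊆ Φ), IsSurjBoundedMorphism h (K Φ) (K Ψ) (f h)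
  f_id : ∀ {Φ : Set At} (h : Φ ⊆ Φ) (x : (K Φ).W), f h x = x
  f_comp : ∀ {Φ Ψ Υ : Set At} (h : Ψ ⊆ Φ) (h' : Υ ⊆ Ψ) (x : (K Φ).W),
    f (h'.trans h) x = f h' (f h x)

/-- Validity in a category of FH models: truth at every state of every model of the category in
which the formula is defined. -/
def FHCategory.Valid {At : Type u} {I : Type v} (C : FHCategory.{u, v, w} At I)
    (φ : Formula At I) : Prop :=
  ∀ Ψ : Set At, φ.atoms ⊆ Ψ → ∀ x : (C.K Ψ).W, (C.K Ψ).Sat φ x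

/-! ### Lattices of state spaces with projections -/

/-- Nonempty state spaces `S Φ`, one for each `Φ ⊆ At`, with commuting surjective projections. -/
structure StateSpaces (At : Type u) where
  S : Set At → Type w
  nonempty : ∀ Φ, Nonempty (S Φ)
  r : ∀ {Φ Ψ : Set At}, Ψ ⊆ Φ → S Φ → S Ψ
  r_surjective : ∀ {Φ Ψ : Set At} (h : Ψ ⊆ Φ), Function.Surjective (r h)
  r_id : ∀ {Φ : Set At} (h : Φ ⊆ Φ) (s : S Φ), r h s = s
  r_comp : ∀ {Φ Ψ Υ : Set At} (h : Ψ ⊆ Φ) (h' : Υ ⊆ Ψ) (s : S Φ),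
    r (h'.trans h) s = r h' (r h s)

namespace StateSpaces

variable {At : Type u} {I : Type v} (L : StateSpaces.{u, w} At)

/-- The disjoint union `Ω` of all state spaces; `ω.1` is the index of the space of `ω`. -/
abbrev Ω : Type (max u w) := Σ Φ : Set At, L.S Φ

/-- The space with index `Φ`, as a subset of `Ω`. -/
def space (Φ : Set At) : Set L.Ω := {ω | ω.1 = Φ}

/-- The projection `ω_Ψ`. -/
abbrev proj (ω : L.Ω) (Ψ : Set At) (h : Ψ ⊆ ω.1) : L.Ω := ⟨Ψ, L.r h ω.2⟩

/-- The projection `D_Ψ` of a set of states to the space with index `Ψ`. -/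
def projSet (D : Set L.Ω) (Ψ : Set At) : Set L.Ω :=
  {ω' | ∃ ω ∈ D, ∃ h : Ψ ⊆ ω.1, ω' = L.proj ω Ψ h}

/-- `D↑`, the set of all states that project to a state in `D`. -/
def up (D : Set L.Ω) : Set L.Ω :=
  {ω' | ∃ ω ∈ D, ∃ h : ω.1 ⊆ ω'.1, L.proj ω' ω.1 h = ω}

/-- An event is given by (the index of) its base-space and its base; so the vacuous events
with different base-spaces are different. -/
structure Event where
  baseSpace : Set At
  base : Set (L.S baseSpace)

variable {L}

/-- The set of states of an event: all states that project into the base. -/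
def Event.states (E : L.Event) : Set L.Ω :=
  {ω | ∃ h : E.baseSpace ⊆ ω.1, L.r h ω.2 ∈ E.base}

/-- Negation of events: complement of the base in the base-space. -/
def Event.neg (E : L.Event) : L.Event := ⟨E.baseSpace, E.baseᶜ⟩

/-- The (index of the) base-space `S([φ])` of the event `[φ]`. The base-space of a conjunction is
the join of the base-spaces; negation, knowledge and awareness keep the base-space. -/
def baseSpaceOf (val : At → L.Event) : Formula At I → Set At
  | .top => ∅
  | .atom p => (val p).baseSpace
  | .neg φ => baseSpaceOf val φ
  | .conj φ ψ => baseSpaceOf val φ ∪ baseSpaceOf val ψ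
  | .ell _ φ => baseSpaceOf val φ
  | .aware _ φ => baseSpaceOf val φ
  | .know _ φ => baseSpaceOf val φ

/-- Satisfaction, for a valuation, implicit and explicit possibility correspondences `Lam` and `Pi`,
and a relation `aw i ω Φ` saying that the awareness level of `i` at `ω` is at least as
expressive as the space with index `Φ`. -/
def Sat (val : At → L.Event) (Lam Pi : I → L.Ω → Set L.Ω) (aw : I → L.Ω → Set At → Prop) :
    Formula At I → L.Ω → Prop
  | .top, _ => True
  | .atom p, ω => ω ∈ (val p).states
  | .neg φ, ω =>
      ω ∈ (Event.neg ⟨baseSpaceOf val φ, {s | Sat val Lam Pi aw φ ⟨_, s⟩}⟩).states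
  | .conj φ ψ, ω => Sat val Lam Pi aw φ ω ∧ Sat val Lam Pi aw ψ ω
  | .ell i φ, ω => Lam i ω ⊆ {ω' | Sat val Lam Pi aw φ ω'}
  | .aware i φ, ω => aw i ω (baseSpaceOf val φ)
  | .know i φ, ω => Pi i ω ⊆ {ω' | Sat val Lam Pi aw φ ω'}

/-- `φ` is defined at `ω`. -/
def DefinedAt (val : At → L.Event) (φ : Formula At I) (ω : L.Ω) : Prop :=
  ∀ p ∈ φ.atoms, ω ∈ (val p).states ∪ (val p).neg.states

end StateSpaces

/-! ### Complemented HMS models -/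

/-- HMS models, with the standing properties of the possibility correspondences. -/
structure HMSModel (At : Type u) (I : Type v) extends StateSpaces.{u, w} At where
  /-- explicit possibility correspondences -/
  Pi : I → toStateSpaces.Ω → Set toStateSpaces.Ω
  Pi_nonempty : ∀ i ω, (Pi i ω).Nonempty
  /-- valuation -/
  val : At → toStateSpaces.Event
  confinement : ∀ i ω, ∃ Ψ ⊆ ω.1, Pi i ω ⊆ toStateSpaces.space Ψ
  generalizedReflexivity : ∀ i ω, ω ∈ toStateSpaces.up (Pi i ω)
  stationarity : ∀ i ω, ∀ ω' ∈ Pi i ω, Pi i ω' = Pi i ω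
  projectionsPreserveIgnorance : ∀ i ω Ψ (h : Ψ ⊆ ω.1),
    toStateSpaces.up (Pi i ω) ⊆ toStateSpaces.up (Pi i (toStateSpaces.proj ω Ψ h))
  projectionsPreserveKnowledge : ∀ i ω Ψ Υ (h : Ψ ⊆ ω.1) (h' : Υ ⊆ Ψ),
    Pi i ω ⊆ toStateSpaces.space Ψ →
      toStateSpaces.projSet (Pi i ω) Υ = Pi i (toStateSpaces.proj ω Υ (h'.trans h))

/-- Complemented HMS models. Strong confinement, `Lam i ω ⊆ space ω.1`, is the case `Ψ = ω.1` of
`Lam_projections` (projections preserve implicit knowledge). -/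
structure ComplementedHMSModel (At : Type u) (I : Type v) extends HMSModel.{u, v, w} At I where
  /-- implicit possibility correspondences -/
  Lam : I → toStateSpaces.Ω → Set toStateSpaces.Ω
  Lam_reflexivity : ∀ i ω, ω ∈ Lam i ω
  Lam_stationarity : ∀ i ω, ∀ ω' ∈ Lam i ω, Lam i ω' = Lam i ω
  Lam_projections : ∀ i ω Ψ (h : Ψ ⊆ ω.1),
    toStateSpaces.projSet (Lam i ω) Ψ = Lam i (toStateSpaces.proj ω Ψ h)
  explicitMeasurability : ∀ i ω, ∀ ω' ∈ Lam i ω, Pi i ω' = Pi i ω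
  implicitMeasurability : ∀ i ω Ψ, Pi i ω ⊆ toStateSpaces.space Ψ →
    ∀ ω' ∈ Pi i ω, Lam i ω' = toStateSpaces.projSet (Lam i ω) Ψ

/-- Satisfaction in a complemented HMS model; awareness at `ω` is given by the space that
contains `Pi i ω`. -/
def ComplementedHMSModel.Sat {At : Type u} {I : Type v} (M : ComplementedHMSModel.{u, v, w} At I)
    (φ : Formula At I) (ω : M.Ω) : Prop :=
  StateSpaces.Sat M.val M.Lam M.Pi
    (fun i ω Φ => ∃ Ψ, M.Pi i ω ⊆ M.space Ψ ∧ Φ ⊆ Ψ) φ ω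

/-- Validity in a complemented HMS model: truth at all states at which the formula is defined. -/
def ComplementedHMSModel.Valid {At : Type u} {I : Type v}
    (M : ComplementedHMSModel.{u, v, w} At I) (φ : Formula At I) : Prop :=
  ∀ ω : M.Ω, StateSpaces.DefinedAt M.val φ ω → M.Sat φ ω

/-! ### Implicit knowledge-based HMS models -/

/-- Implicit knowledge-based HMS models. The awareness function gives the index of a space. -/
structure ImplicitHMSModel (At : Type u) (I : Type v) extends StateSpaces.{u, w} At where
  /-- implicit possibility correspondences -/
  Lam : I → toStateSpaces.Ω → Set toStateSpaces.Ω
  /-- awareness functions -/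
  α : I → toStateSpaces.Ω → Set At
  /-- valuation -/
  val : At → toStateSpaces.Event
  Lam_reflexivity : ∀ i ω, ω ∈ Lam i ω
  Lam_stationarity : ∀ i ω, ∀ ω' ∈ Lam i ω, Lam i ω' = Lam i ω
  Lam_projections : ∀ i ω Ψ (h : Ψ ⊆ ω.1),
    toStateSpaces.projSet (Lam i ω) Ψ = Lam i (toStateSpaces.proj ω Ψ h)
  lackOfConception : ∀ i ω, α i ω ⊆ ω.1
  awarenessMeasurability : ∀ i ω, ∀ ω' ∈ Lam i ω, α i ω' = α i ω
  α_proj_below : ∀ i ω Ψ (h : Ψ ⊆ ω.1), Ψ ⊆ α i ω → α i (toStateSpaces.proj ω Ψ h) = Ψ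
  α_proj_above : ∀ i ω Ψ (h : Ψ ⊆ ω.1), α i ω ⊆ Ψ →
    α i (toStateSpaces.proj ω Ψ h) = α i ω
  α_proj_mono : ∀ i ω Ψ (h : Ψ ⊆ ω.1), α i (toStateSpaces.proj ω Ψ h) ⊆ α i ω

/-- The derived explicit possibility correspondence: the implicit possibility set projected to
the awareness level. -/
def ImplicitHMSModel.derivedPi {At : Type u} {I : Type v} (M : ImplicitHMSModel.{u, v, w} At I)
    (i : I) (ω : M.Ω) : Set M.Ω :=
  M.projSet (M.Lam i ω) (M.α i ω)

/-- Satisfaction in an implicit knowledge-based HMS model. -/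
def ImplicitHMSModel.Sat {At : Type u} {I : Type v} (M : ImplicitHMSModel.{u, v, w} At I)
    (φ : Formula At I) (ω : M.Ω) : Prop :=
  StateSpaces.Sat M.val M.Lam M.derivedPi (fun i ω Φ => Φ ⊆ M.α i ω) φ ω

/-- Validity in an implicit knowledge-based HMS model: truth at all states at which the formula is
defined. -/
def ImplicitHMSModel.Valid {At : Type u} {I : Type v} (M : ImplicitHMSModel.{u, v, w} At I)
    (φ : Formula At I) : Prop :=
  ∀ ω : M.Ω, StateSpaces.DefinedAt M.val φ ω → M.Sat φ ω

/-! ### Soundness and completeness -/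

/-- Every formula of the logic `Λ` is valid. -/
def Sound {At : Type u} {I : Type v} (Λ : Set (Formula At I)) (Valid : Formula At I → Prop) :
    Prop :=
  ∀ φ, φ ∈ Λ → Valid φ

/-- Every valid formula of the language `F` is in the logic `Λ`. -/
def CompleteFor {At : Type u} {I : Type v} (F Λ : Set (Formula At I))
    (Valid : Formula At I → Prop) : Prop :=
  ∀ φ ∈ F, Valid φ → φ ∈ Λ

/-- Validity in the class of categories of FH models. -/
def ValidFHCategories {At : Type u} {I : Type v} (φ : Formula At I) : Prop :=
  ∀ C : FHCategory.{u, v, w} At I, C.Valid φ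

/-- Validity in the class of complemented HMS models. -/
def ValidComplementedHMS {At : Type u} {I : Type v} (φ : Formula At I) : Prop :=
  ∀ M : ComplementedHMSModel.{u, v, w} At I, M.Valid φ

/-- Validity in the class of implicit knowledge-based HMS models. -/
def ValidImplicitHMS {At : Type u} {I : Type v} (φ : Formula At I) : Prop :=
  ∀ M : ImplicitHMSModel.{u, v, w} At I, M.Valid φ

/-! Validity in each of the three classes amounts to truth in all FH models for the set of all
atoms. A category of FH models is determined, as far as truth is concerned, by its model for
`Set.univ`, since bounded morphisms preserve truth and the one from the model for `Set.univ` to any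
other is surjective. In an implicit knowledge-based HMS model the set of states at which a formula
is true is an event, so truth is decided in the most expressive space, which is an FH model. In a
complemented HMS model, measurability forces `Π_i(ω)` to be `Λ_i(ω)` projected to the level of
awareness, so such a model is an implicit knowledge-based one in disguise. Conversely, every FH
model for `Set.univ` is the top of a constant category and of a constant projective system of state
spaces.

Completeness with respect to these FH models is by a canonical model. There the awareness sets are
generated by the atoms of which the agent is aware; they agree with the formulas `a_i φ` of a
complete theory in the presence of the axioms `a_i ⊤` and, without these, for the `φ` in which `⊤`
does not occur. -/

/-! ### Truth in FH models -/

namespace Formula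

variable {At : Type u} {I : Type v} {e : Formula At I → Prop} {φ ψ : Formula At I}

theorem propEval_imp : propEval e (imp φ ψ) ↔ (propEval e φ → propEval e ψ) := by
  simp only [imp, propEval, not_and, not_not]

theorem propEval_biimp : propEval e (biimp φ ψ) ↔ (propEval e φ ↔ propEval e ψ) := by
  simp only [biimp, propEval, propEval_imp, iff_def]

theorem TopFree.topGuarded (h : φ.TopFree) : φ.TopGuarded := by
  induction φ with
  | top | atom => trivial
  | neg _ ih | ell _ _ ih => exact ih h
  | conj _ _ ih₁ ih₂ => exact ⟨ih₁ h.1, ih₂ h.2⟩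
  | aware | know => exact h

end Formula

namespace FHModel

variable {At : Type u} {I : Type v} {Φ : Set At} (K : FHModel.{u, v, w} At I Φ)

theorem propEval_sat (φ : Formula At I) (x : K.W) :
    φ.propEval (fun ψ => K.Sat ψ x) ↔ K.Sat φ x := by
  induction φ with
  | neg _ ih => simp only [Formula.propEval, Sat, ih]
  | conj _ _ ih₁ ih₂ => simp only [Formula.propEval, Sat, ih₁, ih₂]
  | _ => simp only [Formula.propEval, Sat]

theorem sat_imp (φ ψ : Formula At I) (x : K.W) :
    K.Sat (.imp φ ψ) x ↔ (K.Sat φ x → K.Sat ψ x) := by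
  rw [← K.propEval_sat (.imp φ ψ), Formula.propEval_imp, K.propEval_sat, K.propEval_sat]

theorem sat_biimp (φ ψ : Formula At I) (x : K.W) :
    K.Sat (.biimp φ ψ) x ↔ (K.Sat φ x ↔ K.Sat ψ x) := by
  rw [← K.propEval_sat (.biimp φ ψ), Formula.propEval_biimp, K.propEval_sat, K.propEval_sat]

theorem sat_aware_iff (i : I) (φ : Formula At I) (x : K.W) :
    K.Sat (.aware i φ) x ↔ ∀ p ∈ φ.atoms, .atom p ∈ K.A i x := by
  by_cases hφ : φ.atoms ⊆ Φ
  · exact K.generated i x φ hφ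
  · refine iff_of_false (fun h => hφ (K.A_subset i x h)) fun h => hφ fun p hp => ?_
    exact K.A_subset i x (h p hp) rfl

end FHModel

namespace IsSurjBoundedMorphism

variable {At : Type u} {I : Type v} {Φ Ψ : Set At} {h : Ψ ⊆ Φ} {K : FHModel.{u, v, w} At I Φ}
  {K' : FHModel.{u, v, w} At I Ψ} {f : K.W → K'.W}

theorem mem_A_iff (hf : IsSurjBoundedMorphism h K K' f) {φ : Formula At I} (hφ : φ.atoms ⊆ Ψ)
    (i : I) (x : K.W) : φ ∈ K'.A i (f x) ↔ φ ∈ K.A i x := by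
  rw [← hf.awarenessConsistency]
  exact and_iff_left hφ

theorem forall_R_iff (hf : IsSurjBoundedMorphism h K K' f) {P : K'.W → Prop} (i : I) (x : K.W) :
    (∀ y', K'.R i (f x) y' → P y') ↔ ∀ y, K.R i x y → P (f y) := by
  refine ⟨fun H y hy => H _ (hf.homomorphism i x y hy), fun H y' hy' => ?_⟩
  obtain ⟨y, rfl, hy⟩ := hf.back i x y' hy'
  exact H y hy

theorem sat_iff (hf : IsSurjBoundedMorphism h K K' f) {φ : Formula At I} (hφ : φ.atoms ⊆ Ψ)
    (x : K.W) : K'.Sat φ (f x) ↔ K.Sat φ x := by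
  induction φ generalizing x with
  | top => exact Iff.rfl
  | atom p =>
    have hp : p ∈ Ψ := hφ rfl
    simpa only [FHModel.Sat, hp, h hp, exists_true_left] using (hf.atomicHarmony ⟨p, hp⟩ x).symm
  | neg _ ih => exact not_congr (ih hφ x)
  | conj _ _ ih₁ ih₂ =>
    obtain ⟨h₁, h₂⟩ := Set.union_subset_iff.1 hφ
    exact and_congr (ih₁ h₁ x) (ih₂ h₂ x)
  | ell i _ ih => simp only [FHModel.Sat, hf.forall_R_iff, ih hφ]
  | aware i φ => exact hf.mem_A_iff (φ := φ) hφ i x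
  | know i φ ih =>
    simp only [FHModel.Sat, hf.forall_R_iff, ih hφ, hf.mem_A_iff (φ := φ) hφ]

end IsSurjBoundedMorphism

/-- Truth at all states of all FH models for the set of all atoms: the notion of validity to which
validity in each of the three classes of models reduces. -/
def ValidFHModels {At : Type u} {I : Type v} (φ : Formula At I) : Prop :=
  ∀ (K : FHModel.{u, v, w} At I Set.univ) (x : K.W), K.Sat φ x

/-! ### Soundness -/

section Soundness

variable {At : Type u} {I : Type v}

theorem LPAWith.sat {X : Set (Formula At I)} {Φ : Set At} {K : FHModel.{u, v, w} At I Φ}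
    (hX : ∀ ψ ∈ X, ∀ x, K.Sat ψ x) {φ : Formula At I} (hφ : LPAWith X φ) (x : K.W) :
    K.Sat φ x := by
  induction hφ generalizing x with
  | extra h => exact hX _ h x
  | taut h => exact (K.propEval_sat _ x).1 (h _)
  | axK i φ ψ =>
    simp only [K.sat_imp, FHModel.Sat]
    exact fun h y hy => h.2 y hy (h.1 y hy)
  | explicitKnowledge i φ => simp only [K.sat_biimp, FHModel.Sat]
  | axA1 i φ ψ =>
    rw [K.sat_biimp]
    change _ ↔ K.Sat (.aware i φ) x ∧ K.Sat (.aware i ψ) x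
    simp only [K.sat_aware_iff, Formula.atoms, Set.mem_union, or_imp, forall_and]
  | axA2 | axA3 | axA4 | axA5 =>
    simp only [K.sat_biimp, K.sat_aware_iff, Formula.atoms]
  | axA11 i φ | axA12 i φ =>
    rw [K.sat_imp]
    intro h y hy
    simpa only [FHModel.Sat, K.knowAware i x y hy] using h
  | modusPonens _ _ ih₁ ih₂ => exact (K.sat_imp _ _ x).1 (ih₂ x) (ih₁ x)
  | necessitation i _ ih => exact fun y _ => ih y
  | axT i φ =>
    rw [K.sat_imp]
    exact fun h => h x ((K.partitional i).refl x)
  | ax4 i φ =>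
    rw [K.sat_imp]
    exact fun h y hy z hz => h z ((K.partitional i).trans hy hz)
  | ax5 i φ =>
    rw [K.sat_imp]
    exact fun h y hy h' => h fun z hz =>
      h' z ((K.partitional i).trans ((K.partitional i).symm hy) hz)

theorem LPATop_sound : Sound (LPATop At I) ValidFHModels.{u, v, w} := fun _ hφ K x =>
  LPAWith.sat (by
    rintro _ ⟨i, rfl⟩ y
    exact (K.sat_aware_iff i .top y).2 fun _ hp => hp.elim) hφ x

theorem LPA_sound : Sound (LPA At I) ValidFHModels.{u, v, w} := fun _ hφ _ x =>
  LPAWith.sat (fun _ h => h.elim) hφ x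

end Soundness

/-! ### Completeness -/

section Completeness

open Formula

variable {At : Type u} {I : Type v} {X T : Set (Formula At I)} {φ ψ χ : Formula At I}

/-- The theories over the logic with the additional axioms `X`. Closure under necessitation is not
required, as theories serve as sets of formulas that are true at a state. -/
structure IsTheory (X T : Set (Formula At I)) : Prop where
  logic : ∀ {φ}, LPAWith X φ → φ ∈ T
  mp : ∀ {φ ψ}, φ ∈ T → imp φ ψ ∈ T → ψ ∈ T

/-- The theories that contain exactly one of `φ` and `¬φ` for every formula `φ`; these are the
maximal consistent sets of the logic. -/
structure IsCompleteTheory (X T : Set (Formula At I)) : Prop extends IsTheory X T where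
  neg_mem_iff : ∀ φ, neg φ ∈ T ↔ φ ∉ T

theorem isTheory_setOf_LPAWith : IsTheory X {φ | LPAWith X φ} := ⟨id, .modusPonens⟩

namespace IsTheory

theorem mem_of_propEval_imp₂ (hT : IsTheory X T) (hφ : φ ∈ T) (hψ : ψ ∈ T)
    (h : ∀ e, propEval e φ → propEval e ψ → propEval e χ) : χ ∈ T :=
  hT.mp hψ (hT.mp hφ (hT.logic (.taut fun e => by simpa only [propEval_imp] using h e)))

theorem mem_of_propEval_imp (hT : IsTheory X T) (hφ : φ ∈ T)
    (h : ∀ e, propEval e φ → propEval e ψ) : ψ ∈ T :=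
  hT.mem_of_propEval_imp₂ hφ hφ fun e _ => h e

theorem conj_mem_iff (hT : IsTheory X T) : conj φ ψ ∈ T ↔ φ ∈ T ∧ ψ ∈ T :=
  ⟨fun h => ⟨hT.mem_of_propEval_imp h fun _ => And.left,
      hT.mem_of_propEval_imp h fun _ => And.right⟩,
    fun h => hT.mem_of_propEval_imp₂ h.1 h.2 fun _ => And.intro⟩

theorem mem_iff_of_biimp (hT : IsTheory X T) (h : LPAWith X (biimp φ ψ)) : φ ∈ T ↔ ψ ∈ T := by
  obtain ⟨h₁, h₂⟩ := hT.conj_mem_iff.1 (hT.logic h)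
  exact ⟨fun hφ => hT.mp hφ h₁, fun hψ => hT.mp hψ h₂⟩

theorem know_mem_iff (hT : IsTheory X T) (i : I) :
    know i φ ∈ T ↔ ell i φ ∈ T ∧ aware i φ ∈ T :=
  (hT.mem_iff_of_biimp (.explicitKnowledge i φ)).trans hT.conj_mem_iff

theorem aware_mem_iff (hT : IsTheory X T) (i : I) (h : LPAWith X (aware i top) ∨ φ.TopFree) :
    aware i φ ∈ T ↔ ∀ p ∈ φ.atoms, aware i (atom p) ∈ T := by
  induction φ with
  | top => simpa only [TopFree, or_false, atoms, Set.mem_empty_iff_false, false_imp_iff,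
      implies_true, iff_true] using h.imp_left hT.logic
  | atom p => simp only [atoms, Set.mem_singleton_iff, forall_eq]
  | neg φ ih => exact (hT.mem_iff_of_biimp (.axA2 i φ)).trans (ih h)
  | conj φ ψ ih₁ ih₂ =>
    rw [hT.mem_iff_of_biimp (.axA1 i φ ψ), hT.conj_mem_iff, ih₁ (h.imp_right And.left),
      ih₂ (h.imp_right And.right)]
    simp only [atoms, Set.mem_union, or_imp, forall_and]
  | ell j φ ih => exact (hT.mem_iff_of_biimp (.axA5 i j φ)).trans (ih h)
  | aware j φ ih => exact (hT.mem_iff_of_biimp (.axA4 i j φ)).trans (ih h)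
  | know j φ ih => exact (hT.mem_iff_of_biimp (.axA3 i j φ)).trans (ih h)

theorem setOf_imp_mem (hT : IsTheory X T) (χ : Formula At I) : IsTheory X {φ | imp χ φ ∈ T} where
  logic h := hT.mem_of_propEval_imp (hT.logic h) fun e hφ => propEval_imp.2 fun _ => hφ
  mp h₁ h₂ := hT.mem_of_propEval_imp₂ h₁ h₂ fun e => by
    simp only [propEval_imp]
    exact fun hφ hψ hχ => hψ hχ (hφ hχ)

theorem setOf_ell_mem (hT : IsTheory X T) (i : I) : IsTheory X {φ | ell i φ ∈ T} where
  logic h := hT.logic (.necessitation i h)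
  mp h₁ h₂ := hT.mp (hT.conj_mem_iff.2 ⟨h₁, h₂⟩) (hT.logic (.axK i _ _))

theorem sUnion_of_isChain {c : Set (Set (Formula At I))} (hc : IsChain (· ⊆ ·) c)
    (hne : c.Nonempty) (h : ∀ T ∈ c, IsTheory X T) : IsTheory X (⋃₀ c) where
  logic hφ := hne.elim fun T hT => ⟨T, hT, (h T hT).logic hφ⟩
  mp := by
    rintro φ ψ ⟨T₁, hT₁, h₁⟩ ⟨T₂, hT₂, h₂⟩
    rcases hc.total hT₁ hT₂ with hle | hle
    · exact ⟨T₂, hT₂, (h T₂ hT₂).mp (hle h₁) h₂⟩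
    · exact ⟨T₁, hT₁, (h T₁ hT₁).mp h₁ (hle h₂)⟩

theorem exists_maximal_notMem (hT : IsTheory X T) (hφ : φ ∉ T) :
    ∃ T', T ⊆ T' ∧ Maximal (fun T' => IsTheory X T' ∧ φ ∉ T') T' :=
  zorn_subset_nonempty {T' | IsTheory X T' ∧ φ ∉ T'}
    (fun c hc hchain hne => ⟨⋃₀ c,
      ⟨sUnion_of_isChain hchain hne fun _ h => (hc h).1, fun ⟨_, h, hφ'⟩ => (hc h).2 hφ'⟩,
      fun _ => Set.subset_sUnion_of_mem⟩) T ⟨hT, hφ⟩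

end IsTheory

theorem isCompleteTheory_of_maximal (h : Maximal (fun T' => IsTheory X T' ∧ φ ∉ T') T) :
    IsCompleteTheory X T := by
  have hT : IsTheory X T := h.prop.1
  have imp_mem_of_notMem (χ : Formula At I) (hχ : χ ∉ T) : imp χ φ ∈ T := by
    by_contra hcon
    refine hχ (h.le_of_ge ⟨hT.setOf_imp_mem χ, hcon⟩ ?_ ?_)
    · exact fun ψ hψ => hT.mem_of_propEval_imp hψ fun e H => propEval_imp.2 fun _ => H
    · exact hT.logic (.taut fun e => propEval_imp.2 id)
  refine ⟨hT, fun χ => ⟨fun hneg hχ => h.prop.2 ?_, fun hχ => ?_⟩⟩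
  · exact hT.mem_of_propEval_imp₂ hneg hχ fun e h₁ h₂ => (h₁ h₂).elim
  · by_contra hneg
    refine h.prop.2 (hT.mem_of_propEval_imp₂ (imp_mem_of_notMem _ hχ) (imp_mem_of_notMem _ hneg)
      fun e => ?_)
    simp only [propEval_imp, propEval]
    exact fun h₁ h₂ => (em _).elim h₁ h₂

theorem IsTheory.exists_isCompleteTheory (hT : IsTheory X T) (hφ : φ ∉ T) :
    ∃ T', IsCompleteTheory X T' ∧ T ⊆ T' ∧ φ ∉ T' := by
  obtain ⟨T', hTT', hmax⟩ := hT.exists_maximal_notMem hφ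
  exact ⟨T', isCompleteTheory_of_maximal hmax, hTT', hmax.prop.2⟩

/-- The states of the canonical model: the complete theories. -/
abbrev CanonicalState (X : Set (Formula At I)) : Type (max u v) :=
  {T : Set (Formula At I) // IsCompleteTheory X T}

/-- The accessibility relation of the canonical model: whatever is known implicitly at `T` is
true at `T'`. -/
def CanonicalRel (i : I) (T T' : CanonicalState X) : Prop := ∀ φ, ell i φ ∈ T.1 → φ ∈ T'.1

theorem canonicalRel_equivalence (i : I) : Equivalence (CanonicalRel (X := X) i) where
  refl T φ h := T.2.mp h (T.2.logic (.axT i φ))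
  symm {T T'} h φ hφ := by
    by_contra hcon
    have hell : ell i φ ∉ T.1 := fun h' => hcon (T.2.mp h' (T.2.logic (.axT i φ)))
    have hneg : neg (ell i φ) ∈ T'.1 :=
      h _ (T.2.mp ((T.2.neg_mem_iff _).2 hell) (T.2.logic (.ax5 i φ)))
    exact (T'.2.neg_mem_iff _).1 hneg hφ
  trans {T _ _} h h' φ hφ := h' φ (h _ (T.2.mp hφ (T.2.logic (.ax4 i φ))))

theorem ell_mem_iff_forall_canonicalRel {i : I} {T : CanonicalState X} :
    ell i φ ∈ T.1 ↔ ∀ T', CanonicalRel i T T' → φ ∈ T'.1 := by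
  refine ⟨fun h T' hT' => hT' φ h, fun h => ?_⟩
  by_contra hcon
  obtain ⟨T', hT', hsub, hφ⟩ := (T.2.setOf_ell_mem i).exists_isCompleteTheory hcon
  exact hφ (h ⟨T', hT'⟩ fun ψ hψ => hsub hψ)

theorem CanonicalRel.aware_mem_iff {i : I} {T T' : CanonicalState X} (h : CanonicalRel i T T') :
    aware i φ ∈ T.1 ↔ aware i φ ∈ T'.1 := by
  refine ⟨fun hφ => h _ (T.2.mp hφ (T.2.logic (.axA11 i φ))), fun hφ => ?_⟩
  by_contra hcon
  have hneg : neg (aware i φ) ∈ T'.1 :=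
    h _ (T.2.mp ((T.2.neg_mem_iff _).2 hcon) (T.2.logic (.axA12 i φ)))
  exact (T'.2.neg_mem_iff _).1 hneg hφ

/-- The canonical FH model for the set of all atoms. An awareness set is generated by atoms rather
than defined as the set of all `φ` with `a_i φ ∈ T`, which may fail to contain `⊤`. The states are
lifted so that the model may live in any sufficiently large universe. -/
def canonicalModel (X : Set (Formula At I)) [Nonempty (CanonicalState X)] :
    FHModel.{u, v, max u v w} At I Set.univ where
  W := ULift.{w} (CanonicalState X)
  nonempty := inferInstance
  R i T T' := CanonicalRel i T.down T'.down
  A i T := {φ | ∀ p ∈ φ.atoms, aware i (atom p) ∈ T.down.1}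
  V p := {T | atom p.1 ∈ T.down.1}
  A_subset _ _ _ _ := Set.subset_univ _
  generated i T φ _ := by simp only [Set.mem_ofPred_eq, atoms, Set.mem_singleton_iff, forall_eq]
  knowAware i T T' h := Set.ext fun φ => forall₂_congr fun p _ => h.aware_mem_iff
  partitional i := (canonicalRel_equivalence i).comap ULift.down

theorem canonicalModel_sat_iff [Nonempty (CanonicalState X)]
    (h : (∀ i, LPAWith X (aware i top)) ∨ φ.TopGuarded) (T : CanonicalState X) :
    (canonicalModel.{u, v, w} X).Sat φ ⟨T⟩ ↔ φ ∈ T.1 := by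
  have ell_iff {ψ : Formula At I} (i : I) (T : CanonicalState X)
      (ih : ∀ T, (canonicalModel.{u, v, w} X).Sat ψ ⟨T⟩ ↔ ψ ∈ T.1) :
      (canonicalModel.{u, v, w} X).Sat (.ell i ψ) ⟨T⟩ ↔ ell i ψ ∈ T.1 := by
    rw [ell_mem_iff_forall_canonicalRel]
    exact ULift.forall.trans (forall₂_congr fun T' _ => ih T')
  induction φ generalizing T with
  | top => exact iff_of_true trivial (T.2.logic (.taut fun _ => trivial))
  | atom p => exact exists_prop_of_true trivial
  | neg φ ih => exact (not_congr (ih h T)).trans (T.2.neg_mem_iff φ).symm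
  | conj φ ψ ih₁ ih₂ =>
    exact (and_congr (ih₁ (h.imp_right And.left) T) (ih₂ (h.imp_right And.right) T)).trans
      T.2.conj_mem_iff.symm
  | ell i φ ih => exact ell_iff i T (ih h)
  | aware i φ => exact (T.2.aware_mem_iff i (h.imp_left fun h => h i)).symm
  | know i φ ih =>
    rw [T.2.know_mem_iff, T.2.aware_mem_iff i (h.imp_left fun h => h i),
      ← ell_iff i T (ih (h.imp_right TopFree.topGuarded))]
    exact Iff.rfl

theorem LPAWith_of_validFHModels (h : (∀ i, LPAWith X (aware i top)) ∨ φ.TopGuarded)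
    (hφ : ValidFHModels.{u, v, max u v w} φ) : LPAWith X φ := by
  by_contra hcon
  obtain ⟨T, hT, -, hTφ⟩ := isTheory_setOf_LPAWith.exists_isCompleteTheory hcon
  have : Nonempty (CanonicalState X) := ⟨⟨T, hT⟩⟩
  exact hTφ ((canonicalModel_sat_iff.{u, v, w} h ⟨T, hT⟩).1 (hφ _ _))

theorem LPATop_complete : CompleteFor Set.univ (LPATop At I) ValidFHModels.{u, v, max u v w} :=
  fun _ _ => LPAWith_of_validFHModels.{u, v, w} (Or.inl fun i => .extra ⟨i, rfl⟩)

theorem LPA_complete :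
    CompleteFor {φ | φ.TopGuarded} (LPA At I) ValidFHModels.{u, v, max u v w} :=
  fun _ hφ => LPAWith_of_validFHModels.{u, v, w} (Or.inr hφ)

end Completeness

/-! ### Categories of FH models -/

namespace FHModel

variable {At : Type u} {I : Type v} {Φ Ψ : Set At}

/-- The restriction of an FH model to the language of a smaller set of atoms, with the same
states. -/
def restrict (K : FHModel.{u, v, w} At I Φ) (h : Ψ ⊆ Φ) : FHModel.{u, v, w} At I Ψ where
  W := K.W
  nonempty := K.nonempty
  R := K.R
  A i x := K.A i x ∩ Formula.sublanguage Ψ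
  V p := K.V ⟨p, h p.2⟩
  A_subset _ _ := Set.inter_subset_right
  generated i x φ hφ := by
    have hgen := K.generated i x φ (Set.Subset.trans hφ h)
    exact ⟨fun H p hp => ⟨hgen.1 H.1 p hp, Set.singleton_subset_iff.2 (hφ hp)⟩,
      fun H => ⟨hgen.2 fun p hp => (H p hp).1, hφ⟩⟩
  knowAware i x y hxy := by rw [K.knowAware i x y hxy]
  partitional := K.partitional

theorem isSurjBoundedMorphism_restrict (K : FHModel.{u, v, w} At I Φ) (h : Ψ ⊆ Φ) :
    IsSurjBoundedMorphism h K (K.restrict h) id where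
  surjective := Function.surjective_id
  atomicHarmony _ _ := Iff.rfl
  awarenessConsistency _ _ := rfl
  homomorphism _ _ _ hxy := hxy
  back _ _ y hy := ⟨y, rfl, hy⟩

/-- The category of the restrictions of an FH model for the set of all atoms. -/
def toCategory (K : FHModel.{u, v, w} At I Set.univ) : FHCategory.{u, v, w} At I where
  K Φ := K.restrict (Set.subset_univ Φ)
  f _ x := x
  morphism h :=
    { surjective := Function.surjective_id
      atomicHarmony := fun _ _ => Iff.rfl
      awarenessConsistency := fun i x => by
        have hsub : Formula.sublanguage (I := I) _ ⊆ Formula.sublanguage _ :=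
          fun φ (hφ : φ.atoms ⊆ _) => hφ.trans h
        exact (Set.inter_assoc _ _ _).trans
          (congrArg (K.A i x ∩ ·) (Set.inter_eq_right.2 hsub))
      homomorphism := fun _ _ _ hxy => hxy
      back := fun _ _ y hy => ⟨y, rfl, hy⟩ }
  f_id _ _ := rfl
  f_comp _ _ _ := rfl

end FHModel

theorem validFHCategories_iff {At : Type u} {I : Type v} {φ : Formula At I} :
    ValidFHCategories.{u, v, w} φ ↔ ValidFHModels.{u, v, w} φ := by
  constructor
  · intro h K x
    exact ((K.isSurjBoundedMorphism_restrict subset_rfl).sat_iff (Set.subset_univ _) x).1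
      (h K.toCategory Set.univ (Set.subset_univ _) x)
  · intro h C Ψ hφ x
    have hf := C.morphism (Set.subset_univ Ψ)
    obtain ⟨y, rfl⟩ := hf.surjective x
    exact (hf.sat_iff hφ y).2 (h _ y)

/-! ### Events -/

namespace StateSpaces

variable {At : Type u} {I : Type v} {L : StateSpaces.{u, w} At}

theorem proj_eq_self {ω : L.Ω} {Ψ : Set At} (h : Ψ = ω.1) : L.proj ω Ψ h.subset = ω := by
  subst h
  simp only [proj, L.r_id]

theorem proj_proj (ω : L.Ω) {Ψ Υ : Set At} (h : Ψ ⊆ ω.1) (h' : Υ ⊆ Ψ) :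
    L.proj (L.proj ω Ψ h) Υ h' = L.proj ω Υ (h'.trans h) := by
  simp only [proj, L.r_comp h h']

theorem projSet_subset_space (D : Set L.Ω) (Ψ : Set At) : L.projSet D Ψ ⊆ L.space Ψ := by
  rintro _ ⟨_, _, _, rfl⟩
  rfl

theorem up_subset_up_projSet {D : Set L.Ω} {Ψ : Set At} (hD : ∀ ω ∈ D, Ψ ⊆ ω.1) :
    L.up D ⊆ L.up (L.projSet D Ψ) := by
  rintro ω' ⟨ω, hω, h, hproj⟩
  have hΨ := hD ω hω
  refine ⟨L.proj ω Ψ hΨ, ⟨ω, hω, hΨ, rfl⟩, Set.Subset.trans hΨ h, ?_⟩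
  rw [← proj_proj ω' h hΨ]
  simp only [hproj]

theorem Event.states_union_states_neg (E : L.Event) :
    E.states ∪ E.neg.states = {ω | E.baseSpace ⊆ ω.1} := by
  ext ω
  refine ⟨fun h => h.elim Exists.fst Exists.fst, fun h => ?_⟩
  exact (em (L.r h ω.2 ∈ E.base)).imp (fun H => ⟨h, H⟩) (fun H => ⟨h, H⟩)

theorem baseSpaceOf_eq_biUnion (val : At → L.Event) (φ : Formula At I) :
    baseSpaceOf val φ = ⋃ p ∈ φ.atoms, (val p).baseSpace := by
  induction φ with
  | top => exact (Set.biUnion_empty _).symm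
  | atom p => exact (Set.biUnion_singleton p fun q => (val q).baseSpace).symm
  | conj _ _ ih₁ ih₂ => rw [baseSpaceOf, ih₁, ih₂, Formula.atoms, Set.biUnion_union]
  | neg _ ih | ell _ _ ih | aware _ _ ih | know _ _ ih => exact ih

theorem definedAt_iff {val : At → L.Event} {φ : Formula At I} {ω : L.Ω} :
    DefinedAt val φ ω ↔ baseSpaceOf val φ ⊆ ω.1 := by
  simp only [DefinedAt, Event.states_union_states_neg, Set.mem_ofPred_eq, baseSpaceOf_eq_biUnion,
    Set.iUnion₂_subset_iff]

/-- `P` is the set of states of an event with base-space `Φ`, stated without reference to the base: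
its states are at least as expressive as `Φ`, and membership does not change under projections to
such spaces. -/
structure IsEventSet (P : Set L.Ω) (Φ : Set At) : Prop where
  subset_index : ∀ ω ∈ P, Φ ⊆ ω.1
  proj_mem_iff : ∀ (ω : L.Ω) {Ψ : Set At} (h : Ψ ⊆ ω.1), Φ ⊆ Ψ → (L.proj ω Ψ h ∈ P ↔ ω ∈ P)

theorem isEventSet_univ : IsEventSet (Set.univ : Set L.Ω) ∅ :=
  ⟨fun _ _ => Set.empty_subset _, fun _ _ _ _ => Iff.rfl⟩

theorem Event.isEventSet_states (E : L.Event) : IsEventSet E.states E.baseSpace where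
  subset_index _ h := h.1
  proj_mem_iff ω Ψ h hΨ := by
    simp only [states, Set.mem_ofPred_eq, proj, ← L.r_comp h hΨ, hΨ, hΨ.trans h, exists_true_left]

namespace IsEventSet

variable {P Q : Set L.Ω} {Φ Ψ : Set At}

theorem inter (hP : IsEventSet P Φ) (hQ : IsEventSet Q Ψ) : IsEventSet (P ∩ Q) (Φ ∪ Ψ) where
  subset_index ω h := Set.union_subset (hP.subset_index ω h.1) (hQ.subset_index ω h.2)
  proj_mem_iff ω _ h hΥ := and_congr (hP.proj_mem_iff ω h (Set.subset_union_left.trans hΥ))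
    (hQ.proj_mem_iff ω h (Set.subset_union_right.trans hΥ))

theorem projSet_subset_iff (hP : IsEventSet P Φ) (hΨ : Φ ⊆ Ψ) {D : Set L.Ω}
    (hD : ∀ ω ∈ D, Ψ ⊆ ω.1) : L.projSet D Ψ ⊆ P ↔ D ⊆ P := by
  constructor
  · exact fun H ω hω => (hP.proj_mem_iff ω (hD ω hω) hΨ).1 (H ⟨ω, hω, hD ω hω, rfl⟩)
  · rintro H _ ⟨ω, hω, h, rfl⟩
    exact (hP.proj_mem_iff ω h hΨ).2 (H hω)

end IsEventSet

end StateSpaces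

/-! ### Truth in implicit knowledge-based HMS models -/

namespace ImplicitHMSModel

open StateSpaces

variable {At : Type u} {I : Type v} (M : ImplicitHMSModel.{u, v, w} At I) {i : I} {ω ω' : M.Ω}

theorem index_eq_of_mem_Lam (h : ω' ∈ M.Lam i ω) : ω'.1 = ω.1 := by
  have hproj := M.Lam_projections i ω ω.1 subset_rfl
  rw [proj_eq_self rfl] at hproj
  rw [← hproj] at h
  exact projSet_subset_space _ _ h

theorem subset_index_of_mem_Lam {Ψ : Set At} (hΨ : Ψ ⊆ ω.1) : ∀ ω' ∈ M.Lam i ω, Ψ ⊆ ω'.1 :=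
  fun _ h => hΨ.trans (M.index_eq_of_mem_Lam h).superset

theorem proj_α_mem_derivedPi (i : I) (ω : M.Ω) :
    M.proj ω (M.α i ω) (M.lackOfConception i ω) ∈ M.derivedPi i ω :=
  ⟨ω, M.Lam_reflexivity i ω, M.lackOfConception i ω, rfl⟩

theorem isEventSet_Lam_subset (i : I) {P : Set M.Ω} {Φ : Set At} (hP : IsEventSet P Φ) :
    IsEventSet {ω | M.Lam i ω ⊆ P} Φ where
  subset_index ω h := hP.subset_index ω (h (M.Lam_reflexivity i ω))
  proj_mem_iff ω Ψ h hΨ := by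
    change M.Lam i (M.proj ω Ψ h) ⊆ P ↔ M.Lam i ω ⊆ P
    rw [← M.Lam_projections, hP.projSet_subset_iff hΨ (M.subset_index_of_mem_Lam h)]

theorem isEventSet_subset_α (i : I) (Φ : Set At) : IsEventSet {ω : M.Ω | Φ ⊆ M.α i ω} Φ where
  subset_index ω h := Set.Subset.trans h (M.lackOfConception i ω)
  proj_mem_iff ω Ψ h hΨ := by
    refine ⟨fun H => Set.Subset.trans H (M.α_proj_mono i ω Ψ h), fun H => ?_⟩
    calc Φ = M.α i (M.proj ω Φ (hΨ.trans h)) := (M.α_proj_below i ω Φ _ H).symm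
      _ = M.α i (M.proj (M.proj ω Ψ h) Φ hΨ) := by rw [proj_proj]
      _ ⊆ M.α i (M.proj ω Ψ h) := M.α_proj_mono i _ Φ hΨ

theorem derivedPi_subset_iff {P : Set M.Ω} {Φ : Set At} (hP : IsEventSet P Φ) :
    M.derivedPi i ω ⊆ P ↔ M.Lam i ω ⊆ P ∧ Φ ⊆ M.α i ω := by
  have hLam (hΦ : Φ ⊆ M.α i ω) : M.derivedPi i ω ⊆ P ↔ M.Lam i ω ⊆ P :=
    hP.projSet_subset_iff hΦ (M.subset_index_of_mem_Lam (M.lackOfConception i ω))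
  refine ⟨fun H => ?_, fun H => (hLam H.2).2 H.1⟩
  have hΦ : Φ ⊆ M.α i ω := hP.subset_index _ (H (M.proj_α_mem_derivedPi i ω))
  exact ⟨(hLam hΦ).1 H, hΦ⟩

theorem isEventSet_sat (φ : Formula At I) :
    IsEventSet {ω | M.Sat φ ω} (baseSpaceOf M.val φ) := by
  induction φ with
  | top => exact isEventSet_univ
  | atom p => exact (M.val p).isEventSet_states
  | neg φ => exact Event.isEventSet_states (Event.neg ⟨baseSpaceOf M.val φ, _⟩)
  | conj _ _ ih₁ ih₂ => exact ih₁.inter ih₂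
  | ell i _ ih => exact M.isEventSet_Lam_subset i ih
  | aware i φ => exact M.isEventSet_subset_α i _
  | know i φ ih =>
    have hknow :=
      (M.isEventSet_Lam_subset i ih).inter (M.isEventSet_subset_α i (baseSpaceOf M.val φ))
    rw [Set.union_self] at hknow
    have hset : {ω | M.Sat (.know i φ) ω} =
        {ω | M.Lam i ω ⊆ {ω | M.Sat φ ω}} ∩ {ω | baseSpaceOf M.val φ ⊆ M.α i ω} :=
      Set.ext fun _ => M.derivedPi_subset_iff ih
    exact hset ▸ hknow

theorem sat_proj_iff {φ : Formula At I} {Ψ : Set At} (h : Ψ ⊆ ω.1)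
    (hΨ : baseSpaceOf M.val φ ⊆ Ψ) : M.Sat φ (M.proj ω Ψ h) ↔ M.Sat φ ω :=
  (M.isEventSet_sat φ).proj_mem_iff ω h hΨ

theorem sat_know_iff (φ : Formula At I) :
    M.Sat (.know i φ) ω ↔ M.Sat (.ell i φ) ω ∧ M.Sat (.aware i φ) ω :=
  M.derivedPi_subset_iff (M.isEventSet_sat φ)

theorem sat_neg_iff {φ : Formula At I} (h : baseSpaceOf M.val φ ⊆ ω.1) :
    M.Sat (.neg φ) ω ↔ ¬ M.Sat φ ω := by
  rw [← M.sat_proj_iff h subset_rfl]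
  exact exists_prop_of_true h

/-- The most expressive state space, as an FH model for the set of all atoms. -/
def topFHModel : FHModel.{u, v, w} At I Set.univ where
  W := M.S Set.univ
  nonempty := M.nonempty Set.univ
  R i s t := (⟨Set.univ, t⟩ : M.Ω) ∈ M.Lam i ⟨Set.univ, s⟩
  A i s := {φ | baseSpaceOf M.val φ ⊆ M.α i ⟨Set.univ, s⟩}
  V p := {s | (⟨Set.univ, s⟩ : M.Ω) ∈ (M.val p).states}
  A_subset _ _ _ _ := Set.subset_univ _
  generated i s φ _ := by
    simp only [Set.mem_ofPred_eq, baseSpaceOf_eq_biUnion M.val φ, Set.iUnion₂_subset_iff,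
      baseSpaceOf]
  knowAware i s t h := by rw [M.awarenessMeasurability i _ _ h]
  partitional i :=
    { refl := fun s => M.Lam_reflexivity i _
      symm := fun h => by rw [M.Lam_stationarity i _ _ h]; exact M.Lam_reflexivity i _
      trans := fun h h' => by rwa [← M.Lam_stationarity i _ _ h] }

theorem Lam_subset_iff {Φ : Set At} {s : M.S Φ} {P : Set M.Ω} :
    M.Lam i ⟨Φ, s⟩ ⊆ P ↔ ∀ t, (⟨Φ, t⟩ : M.Ω) ∈ M.Lam i ⟨Φ, s⟩ → ⟨Φ, t⟩ ∈ P := by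
  refine ⟨fun H t ht => H ht, ?_⟩
  rintro H ⟨Ψ, t⟩ ht
  obtain rfl : Ψ = Φ := M.index_eq_of_mem_Lam ht
  exact H t ht

theorem topFHModel_sat_iff {φ : Formula At I} (s : M.S Set.univ) :
    M.topFHModel.Sat φ s ↔ M.Sat φ ⟨Set.univ, s⟩ := by
  have ell_iff {ψ : Formula At I} (i : I) (s : M.S Set.univ)
      (ih : ∀ s, M.topFHModel.Sat ψ s ↔ M.Sat ψ ⟨Set.univ, s⟩) :
      M.topFHModel.Sat (.ell i ψ) s ↔ M.Sat (.ell i ψ) ⟨Set.univ, s⟩ :=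
    (forall₂_congr fun t _ => ih t).trans M.Lam_subset_iff.symm
  induction φ generalizing s with
  | top | aware => exact Iff.rfl
  | atom p => exact exists_prop_of_true trivial
  | neg _ ih => exact (not_congr (ih s)).trans (M.sat_neg_iff (Set.subset_univ _)).symm
  | conj _ _ ih₁ ih₂ => exact and_congr (ih₁ s) (ih₂ s)
  | ell i _ ih => exact ell_iff i s ih
  | know i φ ih => exact (and_congr (ell_iff i s ih) Iff.rfl).trans (M.sat_know_iff φ).symm

end ImplicitHMSModel

/-- The projective system all of whose spaces are copies of `W`. -/
abbrev StateSpaces.const (At : Type u) (W : Type w) [Nonempty W] : StateSpaces.{u, w} At where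
  S _ := W
  nonempty _ := inferInstance
  r _ s := s
  r_surjective _ := Function.surjective_id
  r_id _ _ := rfl
  r_comp _ _ _ := rfl

namespace FHModel

open StateSpaces

variable {At : Type u} {I : Type v} (K : FHModel.{u, v, w} At I Set.univ)

/-- The implicit knowledge-based HMS model on copies of the states of an FH model. The event of an
atom `p` has the base-space with index `{p}`. -/
def toImplicit : ImplicitHMSModel.{u, v, w} At I where
  toStateSpaces := haveI := K.nonempty; StateSpaces.const At K.W
  Lam i ω := {ω' | ω'.1 = ω.1 ∧ K.R i ω.2 ω'.2}
  α i ω := {p ∈ ω.1 | .atom p ∈ K.A i ω.2}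
  val p := ⟨{p}, K.V ⟨p, trivial⟩⟩
  Lam_reflexivity i ω := ⟨rfl, (K.partitional i).refl _⟩
  Lam_stationarity := by
    rintro i ω ω' ⟨hΦ, hR⟩
    ext ω''
    exact and_congr (by rw [hΦ]) ⟨(K.partitional i).trans hR,
      (K.partitional i).trans ((K.partitional i).symm hR)⟩
  Lam_projections := by
    rintro i ⟨Φ, x⟩ Ψ h
    ext ⟨Υ, y⟩
    constructor
    · rintro ⟨_, hω', _, he⟩
      cases he
      exact ⟨rfl, hω'.2⟩
    · rintro ⟨rfl, hy⟩
      exact ⟨⟨Φ, y⟩, ⟨rfl, hy⟩, h, rfl⟩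
  lackOfConception i ω := Set.sep_subset _ _
  awarenessMeasurability := by
    rintro i ω ω' ⟨hΦ, hR⟩
    simp only [hΦ, K.knowAware i _ _ hR]
  α_proj_below i ω Ψ h hΨ := Set.Subset.antisymm (Set.sep_subset _ _) fun p hp => ⟨hp, (hΨ hp).2⟩
  α_proj_above i ω Ψ h hΨ :=
    Set.Subset.antisymm (fun p hp => ⟨h hp.1, hp.2⟩) fun p hp => ⟨hΨ hp, hp.2⟩
  α_proj_mono i ω Ψ h p hp := ⟨h hp.1, hp.2⟩

theorem isSurjBoundedMorphism_toImplicit_topFHModel :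
    IsSurjBoundedMorphism subset_rfl K K.toImplicit.topFHModel id where
  surjective := Function.surjective_id
  atomicHarmony _ _ := ⟨fun h => ⟨Set.subset_univ _, h⟩, fun ⟨_, h⟩ => h⟩
  awarenessConsistency i x := by
    ext φ
    change φ ∈ K.A i x ∧ φ.atoms ⊆ Set.univ ↔ baseSpaceOf K.toImplicit.val φ ⊆ _
    rw [K.generated i x φ (Set.subset_univ _), baseSpaceOf_eq_biUnion, Set.iUnion₂_subset_iff]
    simp [toImplicit]
  homomorphism _ _ _ h := ⟨rfl, h⟩
  back _ _ y h := ⟨y, rfl, h.2⟩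

end FHModel

theorem validImplicitHMS_iff {At : Type u} {I : Type v} {φ : Formula At I} :
    ValidImplicitHMS.{u, v, w} φ ↔ ValidFHModels.{u, v, w} φ := by
  constructor
  · intro h K x
    have hx : K.toImplicit.Sat φ ⟨Set.univ, x⟩ :=
      h K.toImplicit _ (StateSpaces.definedAt_iff.2 (Set.subset_univ _))
    exact (K.isSurjBoundedMorphism_toImplicit_topFHModel.sat_iff (Set.subset_univ _) x).1
      ((K.toImplicit.topFHModel_sat_iff x).2 hx)
  · rintro h M ⟨Ψ, s⟩ hs
    obtain ⟨t, rfl⟩ := M.r_surjective (Set.subset_univ Ψ) s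
    exact (M.sat_proj_iff (ω := ⟨Set.univ, t⟩) (Set.subset_univ Ψ)
      (StateSpaces.definedAt_iff.1 hs)).2 ((M.topFHModel_sat_iff t).1 (h M.topFHModel t))

/-! ### Complemented HMS models -/

namespace ComplementedHMSModel

open StateSpaces

variable {At : Type u} {I : Type v} (M : ComplementedHMSModel.{u, v, w} At I) {i : I} {ω ω' : M.Ω}

/-- The index of the space `S_{Π_i(ω)}` that contains `Π_i(ω)`. -/
noncomputable def awarenessLevel (i : I) (ω : M.Ω) : Set At :=
  (M.confinement i ω).choose

theorem awarenessLevel_subset (i : I) (ω : M.Ω) : M.awarenessLevel i ω ⊆ ω.1 :=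
  (M.confinement i ω).choose_spec.1

theorem Pi_subset_space (i : I) (ω : M.Ω) : M.Pi i ω ⊆ M.space (M.awarenessLevel i ω) :=
  (M.confinement i ω).choose_spec.2

theorem Pi_subset_space_iff {Ψ : Set At} : M.Pi i ω ⊆ M.space Ψ ↔ M.awarenessLevel i ω = Ψ := by
  refine ⟨fun h => ?_, fun h => h ▸ M.Pi_subset_space i ω⟩
  obtain ⟨ω', hω'⟩ := M.Pi_nonempty i ω
  exact (M.Pi_subset_space i ω hω').symm.trans (h hω')

theorem awarenessLevel_eq_of_Pi_eq (h : M.Pi i ω' = M.Pi i ω) :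
    M.awarenessLevel i ω' = M.awarenessLevel i ω := by
  rw [← Pi_subset_space_iff, h, Pi_subset_space_iff]

theorem proj_awarenessLevel_mem_Pi (i : I) (ω : M.Ω) :
    M.proj ω (M.awarenessLevel i ω) (M.awarenessLevel_subset i ω) ∈ M.Pi i ω := by
  obtain ⟨⟨Φ, s⟩, hs, h, hproj⟩ := M.generalizedReflexivity i ω
  obtain rfl : Φ = M.awarenessLevel i ω := M.Pi_subset_space i ω hs
  exact hproj ▸ hs

theorem Lam_proj_awarenessLevel_subset_Pi (i : I) (ω : M.Ω) :
    M.Lam i (M.proj ω (M.awarenessLevel i ω) (M.awarenessLevel_subset i ω)) ⊆ M.Pi i ω := by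
  intro ω' hω'
  have hPi : M.Pi i ω' = M.Pi i ω := (M.explicitMeasurability i _ ω' hω').trans
    (M.stationarity i ω _ (M.proj_awarenessLevel_mem_Pi i ω))
  have hindex : ω'.1 = M.awarenessLevel i ω := by
    rw [← M.Lam_projections] at hω'
    exact projSet_subset_space _ _ hω'
  have hlevel : M.awarenessLevel i ω' = ω'.1 :=
    (M.awarenessLevel_eq_of_Pi_eq hPi).trans hindex.symm
  have hmem := M.proj_awarenessLevel_mem_Pi i ω'
  rwa [proj_eq_self hlevel, hPi] at hmem

theorem Pi_eq_projSet_Lam (i : I) (ω : M.Ω) :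
    M.Pi i ω = M.projSet (M.Lam i ω) (M.awarenessLevel i ω) := by
  refine Set.Subset.antisymm (fun ω' hω' => ?_) ?_
  · rw [← M.implicitMeasurability i ω _ (M.Pi_subset_space i ω) ω' hω']
    exact M.Lam_reflexivity i ω'
  · rw [M.Lam_projections i ω _ (M.awarenessLevel_subset i ω)]
    exact M.Lam_proj_awarenessLevel_subset_Pi i ω

theorem awarenessLevel_proj_subset (i : I) (ω : M.Ω) (Ψ : Set At) (h : Ψ ⊆ ω.1) :
    M.awarenessLevel i (M.proj ω Ψ h) ⊆ M.awarenessLevel i ω := by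
  obtain ⟨ω', hω', hindex, -⟩ := M.projectionsPreserveIgnorance i ω Ψ h
    ⟨_, M.proj_awarenessLevel_mem_Pi i ω, subset_rfl, proj_eq_self rfl⟩
  exact (M.Pi_subset_space i _ hω').symm.subset.trans hindex

theorem awarenessLevel_proj_of_subset (i : I) (ω : M.Ω) (Ψ : Set At) (h : Ψ ⊆ ω.1)
    (hΨ : Ψ ⊆ M.awarenessLevel i ω) : M.awarenessLevel i (M.proj ω Ψ h) = Ψ := by
  rw [← Pi_subset_space_iff, ← M.projectionsPreserveKnowledge i ω (M.awarenessLevel i ω) Ψ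
    (M.awarenessLevel_subset i ω) hΨ (M.Pi_subset_space i ω)]
  exact projSet_subset_space _ _

theorem awarenessLevel_proj_of_superset (i : I) (ω : M.Ω) (Ψ : Set At) (h : Ψ ⊆ ω.1)
    (hΨ : M.awarenessLevel i ω ⊆ Ψ) :
    M.awarenessLevel i (M.proj ω Ψ h) = M.awarenessLevel i ω := by
  refine (M.awarenessLevel_proj_subset i ω Ψ h).antisymm ?_
  have hle := M.awarenessLevel_proj_subset i (M.proj ω Ψ h) _ hΨ
  rwa [proj_proj, M.awarenessLevel_proj_of_subset i ω _ _ subset_rfl] at hle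

/-- The implicit knowledge-based HMS model with the same implicit possibility correspondences, and
with the awareness functions given by the explicit ones. -/
noncomputable def toImplicit : ImplicitHMSModel.{u, v, w} At I where
  toStateSpaces := M.toStateSpaces
  Lam := M.Lam
  α := M.awarenessLevel
  val := M.val
  Lam_reflexivity := M.Lam_reflexivity
  Lam_stationarity := M.Lam_stationarity
  Lam_projections := M.Lam_projections
  lackOfConception := M.awarenessLevel_subset
  awarenessMeasurability i ω ω' h :=
    M.awarenessLevel_eq_of_Pi_eq (M.explicitMeasurability i ω ω' h)
  α_proj_below := M.awarenessLevel_proj_of_subset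
  α_proj_above := M.awarenessLevel_proj_of_superset
  α_proj_mono := M.awarenessLevel_proj_subset

theorem toImplicit_sat : M.toImplicit.Sat = M.Sat := by
  have hPi : M.toImplicit.derivedPi = M.Pi :=
    funext₂ fun i ω => (M.Pi_eq_projSet_Lam i ω).symm
  have haware : (fun i ω Φ => Φ ⊆ M.toImplicit.α i ω) =
      fun i (ω : M.Ω) Φ => ∃ Ψ, M.Pi i ω ⊆ M.space Ψ ∧ Φ ⊆ Ψ := by
    funext i ω Φ
    exact propext ⟨fun h => ⟨_, M.Pi_subset_space i ω, h⟩,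
      fun ⟨_, h, hΦ⟩ => hΦ.trans (M.Pi_subset_space_iff.1 h).superset⟩
  unfold ImplicitHMSModel.Sat ComplementedHMSModel.Sat
  rw [hPi, haware]
  rfl

theorem toImplicit_valid_iff {φ : Formula At I} : M.toImplicit.Valid φ ↔ M.Valid φ := by
  unfold ImplicitHMSModel.Valid
  rw [toImplicit_sat]
  exact Iff.rfl

end ComplementedHMSModel

namespace ImplicitHMSModel

open StateSpaces

variable {At : Type u} {I : Type v} (M : ImplicitHMSModel.{u, v, w} At I) {i : I} {ω ω' : M.Ω}

theorem derivedPi_eq_Lam_proj (i : I) (ω : M.Ω) :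
    M.derivedPi i ω = M.Lam i (M.proj ω (M.α i ω) (M.lackOfConception i ω)) :=
  M.Lam_projections i ω _ _

theorem derivedPi_subset_space_iff {Ψ : Set At} :
    M.derivedPi i ω ⊆ M.space Ψ ↔ M.α i ω = Ψ := by
  refine ⟨fun h => h (M.proj_α_mem_derivedPi i ω), ?_⟩
  rintro rfl
  exact projSet_subset_space _ _

theorem derivedPi_eq_Lam_of_mem_derivedPi (h : ω' ∈ M.derivedPi i ω) :
    M.derivedPi i ω' = M.Lam i ω' := by
  have hindex : ω'.1 = M.α i ω := M.derivedPi_subset_space_iff.2 rfl h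
  rw [derivedPi_eq_Lam_proj] at h
  have hα : M.α i ω' = ω'.1 := by
    rw [M.awarenessMeasurability i _ _ h, M.α_proj_below i ω _ _ subset_rfl, hindex]
  rw [derivedPi_eq_Lam_proj, proj_eq_self hα]

theorem Lam_eq_derivedPi_of_mem_derivedPi (h : ω' ∈ M.derivedPi i ω) :
    M.Lam i ω' = M.derivedPi i ω := by
  rw [derivedPi_eq_Lam_proj] at h ⊢
  exact M.Lam_stationarity i _ _ h

theorem projSet_derivedPi {Υ : Set At} (h : Υ ⊆ M.α i ω) :
    M.projSet (M.derivedPi i ω) Υ =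
      M.Lam i (M.proj ω Υ (h.trans (M.lackOfConception i ω))) := by
  rw [derivedPi_eq_Lam_proj, M.Lam_projections i _ Υ h, proj_proj]

/-- The complemented HMS model whose explicit possibility correspondences are the derived ones. -/
def toComplemented : ComplementedHMSModel.{u, v, w} At I where
  toStateSpaces := M.toStateSpaces
  Pi := M.derivedPi
  Pi_nonempty i ω := ⟨_, M.proj_α_mem_derivedPi i ω⟩
  val := M.val
  confinement i ω := ⟨M.α i ω, M.lackOfConception i ω, projSet_subset_space _ _⟩
  generalizedReflexivity i ω :=
    ⟨_, M.proj_α_mem_derivedPi i ω, M.lackOfConception i ω, rfl⟩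
  stationarity i ω ω' h :=
    (M.derivedPi_eq_Lam_of_mem_derivedPi h).trans (M.Lam_eq_derivedPi_of_mem_derivedPi h)
  projectionsPreserveIgnorance i ω Ψ h := by
    have hα := M.α_proj_mono i ω Ψ h
    rw [M.derivedPi_eq_Lam_proj i (M.proj ω Ψ h), proj_proj, ← M.projSet_derivedPi hα]
    exact up_subset_up_projSet fun ω' hω' =>
      hα.trans (M.derivedPi_subset_space_iff.2 rfl hω').superset
  projectionsPreserveKnowledge i ω Ψ Υ h h' hΨ := by
    obtain rfl := M.derivedPi_subset_space_iff.1 hΨ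
    rw [M.projSet_derivedPi h', derivedPi_eq_Lam_proj,
      proj_eq_self (ω := M.proj ω Υ (h'.trans h)) (M.α_proj_below i ω Υ _ h')]
  Lam := M.Lam
  Lam_reflexivity := M.Lam_reflexivity
  Lam_stationarity := M.Lam_stationarity
  Lam_projections := M.Lam_projections
  explicitMeasurability i ω ω' h := by
    rw [derivedPi, M.Lam_stationarity i ω ω' h, M.awarenessMeasurability i ω ω' h, derivedPi]
  implicitMeasurability i ω Ψ hΨ ω' h := by
    obtain rfl := M.derivedPi_subset_space_iff.1 hΨ
    exact M.Lam_eq_derivedPi_of_mem_derivedPi h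

theorem toImplicit_toComplemented : M.toComplemented.toImplicit = M := by
  have hα : M.toComplemented.awarenessLevel = M.α := funext₂ fun i ω =>
    M.toComplemented.Pi_subset_space_iff.1 (M.derivedPi_subset_space_iff.2 rfl)
  simp only [ComplementedHMSModel.toImplicit, hα]
  rfl

end ImplicitHMSModel

theorem validComplementedHMS_iff_validImplicitHMS {At : Type u} {I : Type v}
    {φ : Formula At I} : ValidComplementedHMS.{u, v, w} φ ↔ ValidImplicitHMS.{u, v, w} φ := by
  constructor
  · intro h M
    rw [← M.toImplicit_toComplemented]
    exact M.toComplemented.toImplicit_valid_iff.2 (h _)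
  · exact fun h M => M.toImplicit_valid_iff.1 (h _)

theorem mainTheorem1 {At : Type u} {I : Type v} [Nonempty At] [Nonempty I] :
    -- the logic with the axioms `a_i ⊤`: sound and complete for the whole language
    ((Sound (LPATop At I) ValidFHCategories.{u, v, max u v w} ∧
        CompleteFor Set.univ (LPATop At I) ValidFHCategories.{u, v, max u v w}) ∧
      (Sound (LPATop At I) ValidComplementedHMS.{u, v, max u v w} ∧
        CompleteFor Set.univ (LPATop At I) ValidComplementedHMS.{u, v, max u v w}) ∧
      (Sound (LPATop At I) ValidImplicitHMS.{u, v, max u v w} ∧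
        CompleteFor Set.univ (LPATop At I) ValidImplicitHMS.{u, v, max u v w})) ∧
    -- the logic without them: sound, and complete for the formulas in which `⊤` is not in the
    -- scope of an awareness or explicit knowledge operator
    ((Sound (LPA At I) ValidFHCategories.{u, v, max u v w} ∧
        CompleteFor {φ | φ.TopGuarded} (LPA At I) ValidFHCategories.{u, v, max u v w}) ∧
      (Sound (LPA At I) ValidComplementedHMS.{u, v, max u v w} ∧
        CompleteFor {φ | φ.TopGuarded} (LPA At I) ValidComplementedHMS.{u, v, max u v w}) ∧
      (Sound (LPA At I) ValidImplicitHMS.{u, v, max u v w} ∧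
        CompleteFor {φ | φ.TopGuarded} (LPA At I) ValidImplicitHMS.{u, v, max u v w})) := by
  have hFH : ValidFHCategories.{u, v, max u v w} = ValidFHModels (At := At) (I := I) :=
    funext fun _ => propext validFHCategories_iff
  have hImplicit : ValidImplicitHMS.{u, v, max u v w} = ValidFHModels (At := At) (I := I) :=
    funext fun _ => propext validImplicitHMS_iff
  have hComplemented :
      ValidComplementedHMS.{u, v, max u v w} = ValidImplicitHMS (At := At) (I := I) :=
    funext fun _ => propext validComplementedHMS_iff_validImplicitHMS
  rw [hComplemented, hImplicit, hFH]
  have hTop : Sound (LPATop At I) ValidFHModels ∧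
      CompleteFor Set.univ (LPATop At I) ValidFHModels :=
    ⟨LPATop_sound, LPATop_complete.{u, v, w}⟩
  have hLPA : Sound (LPA At I) ValidFHModels ∧
      CompleteFor {φ | φ.TopGuarded} (LPA At I) ValidFHModels :=
    ⟨LPA_sound, LPA_complete.{u, v, w}⟩
  exact ⟨⟨hTop, hTop, hTop⟩, hLPA, hLPA, hLPA⟩
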